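/- For $t>0$ let $\gamma_t(x)=(2\pi t)^{-d/2}e^{-|x|^2/(2t)}$ be the density of the centered Gaussian on $\mathbb{R}^d$ with covariance matrix $tI_d$, and for a probability measure $\pi$ on $\mathbb{R}^d$ let $\pi\gamma_t$ be the probability measure whose density is proportional to $\gamma_t$ times that of $\pi$. For $q>1$ and probability measures $\mu\ll\nu$, let $$\mathcal{R}_q(\mu\,\|\,\nu)=\frac{1}{q-1}\log\int\Bigl(\frac{d\mu}{d\nu}\Bigr)^q\,d\nu$$ be the $q$-Rényi divergence, with $\mathcal{R}_q(\mu\,\|\,\nu)=\infty$ if $\mu\not\ll\nu$. Lemma (Closeness). Let $\pi$ be a log-concave probability measure on $\mathbb{R}^d$, that is, one with a density $f:\mathbb{R}^d\to[0,\infty)$ with respect to Lebesgue measure such that $-\log f:\mathbb{R}^d\to(-\infty,\infty]$ is convex. Let $R\ge 0$ with $\mathbb{E}_\pi|x|^2=R^2$. Then for all $\alpha>0$, $\sigma>0$ and $q>1$, $$\mathcal{R}_q\bigl(\pi\gamma_{\sigma^2}\,\|\,\pi\gamma_{\sigma^2(1+\alpha)}\bigr)\le\frac{q^2\alpha^2R^2}{2\sigma^2}.$$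 In particular, if $\alpha\le\sigma/(qR)$ (that is, $\alpha qR\le\sigma$), then $\mathcal{R}_q\bigl(\pi\gamma_{\sigma^2}\,\|\,\pi\gamma_{\sigma^2(1+\alpha)}\bigr)\le\frac12$; so the two measures are $O(1)$-close in $\mathcal{R}_q$, with a universal constant. -/

import Mathlib

open MeasureTheory

noncomputable section

/-- A function `f : ℝᵈ → [0, ∞)` is log-concave if `-log f` is convex as a function with values in
`(-∞, ∞]`: its domain `{f > 0}` is convex, and `-log f` is convex there (it is `+∞` elsewhere). -/
def IsLogConcave {d : ℕ} (f : EuclideanSpace ℝ (Fin d) → ℝ) : Prop :=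
  (∀ x, 0 ≤ f x) ∧ ConvexOn ℝ {x | 0 < f x} (fun x => -Real.log (f x))

/-- A measure on `ℝᵈ` is log-concave if it has a log-concave density with respect to the
Lebesgue measure. -/
def IsLogConcaveMeasure {d : ℕ} (π : Measure (EuclideanSpace ℝ (Fin d))) : Prop :=
  ∃ f : EuclideanSpace ℝ (Fin d) → ℝ, Measurable f ∧ IsLogConcave f ∧
    π = volume.withDensity (fun x => ENNReal.ofReal (f x))

/-- The Lebesgue density of the centered Gaussian distribution on `ℝᵈ` with covariance matrix
`t • 1`, for `t > 0`. -/
def gaussianDensity (d : ℕ) (t : ℝ) (x : EuclideanSpace ℝ (Fin d)) : ℝ :=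
  (2 * Real.pi * t) ^ (-(d : ℝ) / 2) * Real.exp (-‖x‖ ^ 2 / (2 * t))

/-- The distribution `π γ_t`, where `γ_t` is the centered Gaussian with covariance matrix `t • 1`:
if `π` has Lebesgue density `p`, this is the measure whose density is the normalization
`p γ_t / ∫ p γ_t` of the product of the two densities. -/
def gaussianTilt {d : ℕ} (π : Measure (EuclideanSpace ℝ (Fin d))) (t : ℝ) :
    Measure (EuclideanSpace ℝ (Fin d)) :=
  (∫⁻ x, ENNReal.ofReal (gaussianDensity d t x) ∂π)⁻¹ •
    π.withDensity (fun x => ENNReal.ofReal (gaussianDensity d t x))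

open Classical in
/-- The `q`-Rényi divergence `R_q(μ ‖ ν) = (q - 1)⁻¹ log ∫ (dμ/dν)^q dν` for `q > 1` and
`μ ≪ ν`, with values in `[-∞, ∞]`; it is `∞` if `μ` is not absolutely continuous with respect
to `ν`. -/
def renyiDiv {Ω : Type*} [MeasurableSpace Ω] (q : ℝ) (μ ν : Measure Ω) : EReal :=
  if μ ≪ ν then ((1 / (q - 1) : ℝ) : EReal) * ENNReal.log (∫⁻ x, (μ.rnDeriv ν x) ^ q ∂ν)
  else ⊤

end

/-!
Write `F s = log ∫ exp (-s ‖x‖² / 2) dπ`. The measures `π γ_t` form the exponential family generated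
by `-‖x‖² / 2` with parameter `s = 1 / t`, so with `s = 1 / σ²`, `s' = 1 / (σ² (1 + α))` and
`r = q s - (q - 1) s'` the Rényi divergence is a second difference of `F`:
`(q - 1) R_q = F r - q F s + (q - 1) F s'` (`renyiDiv_gaussianTilt`).

Log-concavity of `π` enters through the Prékopa–Leindler inequality. The function
`(x, t) ↦ ‖x‖² / t` is jointly convex, so `f x * exp (-‖x‖² / (2 t))` is jointly log-concave when
the density `f` of `π` is, and hence its marginal `t ↦ F (1 / t)` is concave on `t > 0`
(`IsLogConcaveMeasure.log_sqNormLaplace_concave`). The variance `σ²` is a convex combination of `1 / r`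
and `1 / s' = σ² (1 + α)`, and the concavity inequality there turns the second difference into a
first one: `R_q ≤ α / (1 + α) * (F s' - F r)`.

Finally `F` is convex with `F 0 = 0`, so its increments from `s'` to `r` are at least those given by
its slope from the origin to `s'` (`log_sqNormLaplace_le`), and this slope is at least `-R² / 2` by
Jensen's inequality (`neg_mul_le_log_sqNormLaplace`). The result is
`R_q ≤ q α² R² / (2 σ² (1 + α)²)`, slightly stronger than the bound claimed.

The Prékopa–Leindler inequality is proved for `ℝ` by comparing superlevel sets with the
one-dimensional Brunn–Minkowski inequality, and passes to products by Tonelli's theorem.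
-/

noncomputable section
open scoped ENNReal Pointwise

/-! ### The Prékopa–Leindler inequality -/

/-- The one-dimensional Brunn–Minkowski inequality for compact sets: the translates
`K + min L` and `max K + L` lie in `K + L` and overlap in a single point. -/
theorem volume_add_volume_le_of_isCompact {K L C : Set ℝ} (hK : IsCompact K) (hL : IsCompact L)
    (hK0 : K.Nonempty) (hL0 : L.Nonempty) (hC : ∀ x ∈ K, ∀ y ∈ L, x + y ∈ C) :
    volume K + volume L ≤ volume C := by
  obtain ⟨M, hMK, hM⟩ := hK.exists_isGreatest hK0
  obtain ⟨m, hmL, hm⟩ := hL.exists_isLeast hL0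
  have hdisj : AEDisjoint volume ((fun x => x + m) '' K) ((fun y => M + y) '' L) := by
    refine measure_mono_null (t := {M + m}) ?_ (measure_singleton _)
    rintro _ ⟨⟨x, hx, rfl⟩, ⟨y, hy, hxy⟩⟩
    have h1 := hM hx
    have h2 := hm hy
    simp only [Set.mem_singleton_iff] at hxy ⊢
    linarith
  have hmeas : MeasurableSet ((fun y => M + y) '' L) :=
    (hL.image (by fun_prop)).measurableSet
  calc volume K + volume L
      = volume ((fun x => x + m) '' K) + volume ((fun y => M + y) '' L) := by
        rw [Set.image_add_right, Set.image_add_left, measure_preimage_add_right,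
          measure_preimage_add]
    _ = volume ((fun x => x + m) '' K ∪ (fun y => M + y) '' L) :=
        (measure_union₀ hmeas.nullMeasurableSet hdisj).symm
    _ ≤ volume C := by
        apply measure_mono
        rintro _ (⟨x, hx, rfl⟩ | ⟨y, hy, rfl⟩)
        · exact hC x hx m hmL
        · exact hC M hMK y hy

/-- The one-dimensional Brunn–Minkowski inequality for measurable sets. -/
theorem volume_add_volume_le {A B C : Set ℝ} (hA : MeasurableSet A) (hB : MeasurableSet B)
    (hA0 : A.Nonempty) (hB0 : B.Nonempty) (hC : ∀ x ∈ A, ∀ y ∈ B, x + y ∈ C) :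
    volume A + volume B ≤ volume C := by
  have key : ∀ K ⊆ A, ∀ L ⊆ B, IsCompact K → IsCompact L → volume K + volume L ≤ volume C := by
    intro K hKA L hLB hK hL
    obtain ⟨x, hx⟩ := hA0
    obtain ⟨y, hy⟩ := hB0
    refine le_trans (add_le_add (measure_mono (Set.subset_insert x K))
      (measure_mono (Set.subset_insert y L)))
      (volume_add_volume_le_of_isCompact (hK.insert x) (hL.insert y) (Set.insert_nonempty _ _)
        (Set.insert_nonempty _ _) fun u hu v hv => hC u ?_ v ?_)
    · exact Set.insert_subset hx hKA hu
    · exact Set.insert_subset hy hLB hv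
  have hA' : volume A = ⨆ K : {K // K ⊆ A ∧ IsCompact K}, volume K.1 := by
    rw [hA.measure_eq_iSup_isCompact, iSup_subtype]
    simp only [iSup_and]
  have hB' : volume B = ⨆ K : {K // K ⊆ B ∧ IsCompact K}, volume K.1 := by
    rw [hB.measure_eq_iSup_isCompact, iSup_subtype]
    simp only [iSup_and]
  have : Nonempty {K // K ⊆ A ∧ IsCompact K} := ⟨∅, by simp⟩
  have : Nonempty {K // K ⊆ B ∧ IsCompact K} := ⟨∅, by simp⟩
  rw [hA', hB']
  exact ENNReal.iSup_add_iSup_le fun K L => key K.1 K.2.1 L.1 L.2.1 K.2.2 L.2.2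

theorem weighted_volume_add_le {A B C : Set ℝ} {a b : ℝ} (ha : 0 < a) (hb : 0 < b)
    (hA : MeasurableSet A) (hB : MeasurableSet B)
    (hA0 : A.Nonempty) (hB0 : B.Nonempty) (hC : ∀ x ∈ A, ∀ y ∈ B, a * x + b * y ∈ C) :
    ENNReal.ofReal a * volume A + ENNReal.ofReal b * volume B ≤ volume C := by
  have h := volume_add_volume_le (hA.const_smul_of_ne_zero ha.ne')
    (hB.const_smul_of_ne_zero hb.ne') hA0.smul_set hB0.smul_set (C := C) (by
      rintro _ ⟨x, hx, rfl⟩ _ ⟨y, hy, rfl⟩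
      exact hC x hx y hy)
  simpa [Measure.addHaar_smul, abs_of_pos ha, abs_of_pos hb] using h

/-- The layer-cake formula for functions with values in `[0, ∞)`. -/
theorem lintegral_eq_lintegral_volume_lt {f : ℝ → ℝ≥0∞} (hf : Measurable f) (hf' : ∀ x, f x ≠ ⊤) :
    ∫⁻ x, f x = ∫⁻ t in Set.Ioi (0 : ℝ), volume {x | ENNReal.ofReal t < f x} := by
  have h := lintegral_eq_lintegral_meas_lt (f := fun x => (f x).toReal) volume
    (Filter.Eventually.of_forall fun x => ENNReal.toReal_nonneg) hf.ennreal_toReal.aemeasurable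
  simp only [ENNReal.ofReal_toReal (hf' _)] at h
  rw [h]
  refine setLIntegral_congr_fun measurableSet_Ioi fun t ht => ?_
  simp only [ENNReal.ofReal_lt_iff_lt_toReal (le_of_lt ht) (hf' _)]

/-- The Prékopa–Leindler inequality on `ℝ` for functions of supremum one, in its stronger additive
form: it suffices to compare superlevel sets. -/
theorem add_lintegral_le_of_iSup_eq_one {f g h : ℝ → ℝ≥0∞} {a b : ℝ} (ha : 0 < a) (hb : 0 < b)
    (hab : a + b = 1) (hf : Measurable f) (hg : Measurable g) (hh : Measurable h)
    (hf1 : ⨆ x, f x = 1) (hg1 : ⨆ x, g x = 1)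
    (H : ∀ x y, f x ^ a * g y ^ b ≤ h (a * x + b * y)) :
    ENNReal.ofReal a * (∫⁻ x, f x) + ENNReal.ofReal b * (∫⁻ x, g x) ≤ ∫⁻ x, h x := by
  have hfle : ∀ x, f x ≤ 1 := fun x => hf1 ▸ le_iSup f x
  have hgle : ∀ x, g x ≤ 1 := fun x => hg1 ▸ le_iSup g x
  -- Truncating `h` at one makes it finite and keeps its superlevel sets below height one.
  have hmin : ∫⁻ x, min (h x) 1 ≤ ∫⁻ x, h x := lintegral_mono fun x => min_le_left _ _
  refine le_trans ?_ hmin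
  rw [lintegral_eq_lintegral_volume_lt hf fun x => ((hfle x).trans_lt ENNReal.one_lt_top).ne,
    lintegral_eq_lintegral_volume_lt hg fun x => ((hgle x).trans_lt ENNReal.one_lt_top).ne,
    lintegral_eq_lintegral_volume_lt (hh.min measurable_const)
      fun x => ((min_le_right _ _).trans_lt ENNReal.one_lt_top).ne,
    ← lintegral_const_mul' _ _ ENNReal.ofReal_ne_top,
    ← lintegral_const_mul' _ _ ENNReal.ofReal_ne_top]
  refine (le_lintegral_add _ _).trans (setLIntegral_mono_ae' measurableSet_Ioi ?_)
  refine Filter.Eventually.of_forall fun t (ht : 0 < t) => ?_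
  rcases lt_or_ge t 1 with ht1 | ht1
  · have ht1' : ENNReal.ofReal t < 1 := by simpa using ht1
    have hne : ∀ u : ℝ → ℝ≥0∞, ⨆ x, u x = 1 → {x | ENNReal.ofReal t < u x}.Nonempty :=
      fun u hu => lt_iSup_iff.1 (ht1'.trans_eq hu.symm)
    refine weighted_volume_add_le ha hb (measurableSet_lt measurable_const hf)
      (measurableSet_lt measurable_const hg) (hne f hf1) (hne g hg1)
      fun x hx y hy => lt_min (lt_of_lt_of_le ?_ (H x y)) ht1'
    calc ENNReal.ofReal t = ENNReal.ofReal t ^ a * ENNReal.ofReal t ^ b := by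
          rw [← ENNReal.rpow_add_of_nonneg _ _ ha.le hb.le, hab, ENNReal.rpow_one]
      _ < f x ^ a * g y ^ b :=
          ENNReal.mul_lt_mul (ENNReal.rpow_lt_rpow hx ha) (ENNReal.rpow_lt_rpow hy hb)
  -- Above height one the superlevel sets of `f` and `g` are empty.
  · have hempty : ∀ u : ℝ → ℝ≥0∞, (∀ x, u x ≤ 1) → {x | ENNReal.ofReal t < u x} = ∅ := by
      intro u hu
      ext x
      simpa using (hu x).trans (by simpa using ht1)
    simp [hempty f hfle, hempty g hgle]

theorem ENNReal.geom_mean_le_arith_mean {a b : ℝ} (ha : 0 < a) (hb : 0 < b) (hab : a + b = 1)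
    (u v : ℝ≥0∞) : u ^ a * v ^ b ≤ ENNReal.ofReal a * u + ENNReal.ofReal b * v := by
  have hpq : (a⁻¹).HolderConjugate b⁻¹ :=
    Real.holderConjugate_iff.2 ⟨(one_lt_inv₀ ha).2 (by linarith), by simpa using hab⟩
  have h := ENNReal.young_inequality (u ^ a) (v ^ b) hpq
  rwa [← ENNReal.rpow_mul, ← ENNReal.rpow_mul, mul_inv_cancel₀ ha.ne', mul_inv_cancel₀ hb.ne',
    ENNReal.rpow_one, ENNReal.rpow_one, ENNReal.ofReal_inv_of_pos ha, ENNReal.ofReal_inv_of_pos hb,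
    div_eq_mul_inv, div_eq_mul_inv, inv_inv, inv_inv, mul_comm u, mul_comm v] at h

/-- The Prékopa–Leindler inequality on `ℝ` for bounded functions: dividing `f` and `g` by their
suprema reduces it to the additive form and the inequality of arithmetic and geometric means. -/
theorem prekopaLeindler_real_of_iSup_ne_top {f g h : ℝ → ℝ≥0∞} {a b : ℝ} (ha : 0 < a) (hb : 0 < b)
    (hab : a + b = 1) (hf : Measurable f) (hg : Measurable g) (hh : Measurable h)
    (hf1 : ⨆ x, f x ≠ ⊤) (hg1 : ⨆ x, g x ≠ ⊤)
    (H : ∀ x y, f x ^ a * g y ^ b ≤ h (a * x + b * y)) :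
    (∫⁻ x, f x) ^ a * (∫⁻ x, g x) ^ b ≤ ∫⁻ x, h x := by
  set A := ⨆ x, f x with hA
  set B := ⨆ x, g x with hB
  by_cases hA0 : A = 0
  · have : ∀ x, f x = 0 := fun x => le_antisymm (hA0 ▸ le_iSup f x) zero_le
    simp [this, ha]
  by_cases hB0 : B = 0
  · have : ∀ x, g x = 0 := fun x => le_antisymm (hB0 ▸ le_iSup g x) zero_le
    simp [this, hb]
  have hfac : ∀ u v : ℝ≥0∞,
      (A⁻¹ * u) ^ a * (B⁻¹ * v) ^ b = (A⁻¹ ^ a * B⁻¹ ^ b) * (u ^ a * v ^ b) := by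
    intro u v
    rw [ENNReal.mul_rpow_of_nonneg _ _ ha.le, ENNReal.mul_rpow_of_nonneg _ _ hb.le]
    ring
  set c := A⁻¹ ^ a * B⁻¹ ^ b with hc
  have hc0 : c ≠ 0 := mul_ne_zero
    (by simp [ENNReal.rpow_eq_zero_iff, hf1, ha.not_gt])
    (by simp [ENNReal.rpow_eq_zero_iff, hg1, hb.not_gt])
  have hct : c ≠ ⊤ := ENNReal.mul_ne_top
    (ENNReal.rpow_ne_top_of_nonneg ha.le (by simpa using hA0))
    (ENNReal.rpow_ne_top_of_nonneg hb.le (by simpa using hB0))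
  have h1 := add_lintegral_le_of_iSup_eq_one ha hb hab (hf.const_mul A⁻¹) (hg.const_mul B⁻¹)
    (hh.const_mul c)
    (by rw [← ENNReal.mul_iSup, ENNReal.inv_mul_cancel hA0 hf1])
    (by rw [← ENNReal.mul_iSup, ENNReal.inv_mul_cancel hB0 hg1])
    (fun x y => by rw [hfac]; exact mul_le_mul_right (H x y) c)
  have h2 := (ENNReal.geom_mean_le_arith_mean ha hb hab _ _).trans h1
  rw [lintegral_const_mul _ hf, lintegral_const_mul _ hg, lintegral_const_mul _ hh, hfac] at h2
  exact (ENNReal.mul_le_mul_iff_right hc0 hct).1 h2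

/-- The statement of the Prékopa–Leindler inequality with weights `a` and `b` for the measure `μ`
on the vector space `E`. -/
def PrekopaLeindler {E : Type*} [AddCommGroup E] [Module ℝ E] [MeasurableSpace E] (μ : Measure E)
    (a b : ℝ) : Prop :=
  ∀ f g h : E → ℝ≥0∞, Measurable f → Measurable g → Measurable h →
    (∀ x y, f x ^ a * g y ^ b ≤ h (a • x + b • y)) →
      (∫⁻ x, f x ∂μ) ^ a * (∫⁻ x, g x ∂μ) ^ b ≤ ∫⁻ x, h x ∂μ

theorem prekopaLeindler_real {a b : ℝ} (ha : 0 < a) (hb : 0 < b) (hab : a + b = 1) :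
    PrekopaLeindler (volume : Measure ℝ) a b := by
  intro f g h hf hg hh H
  -- Unbounded functions are handled by truncation at height `n` and monotone convergence.
  have htrunc : ∀ u : ℝ → ℝ≥0∞, Measurable u →
      ∫⁻ x, u x = ⨆ n : ℕ, ∫⁻ x, min (u x) n := by
    intro u hu
    rw [← lintegral_iSup (fun n => hu.min measurable_const)
      (fun m n hmn x => min_le_min_left _ (by exact_mod_cast hmn))]
    congr with x
    rw [← inf_iSup_eq, ENNReal.iSup_natCast, inf_top_eq]
  have hbdd : ∀ (u : ℝ → ℝ≥0∞) (n : ℕ), ⨆ x, min (u x) (n : ℝ≥0∞) ≠ ⊤ := fun u n =>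
    ((iSup_le fun x => min_le_right _ _).trans_lt (ENNReal.natCast_lt_top n)).ne
  have hsup : ∀ {c : ℝ}, 0 < c → ∀ u : ℕ → ℝ≥0∞, (⨆ n, u n) ^ c = ⨆ n, u n ^ c := fun hc u =>
    (ENNReal.orderIsoRpow _ hc).map_iSup u
  rw [htrunc f hf, htrunc g hg, hsup ha, hsup hb]
  simp only [ENNReal.iSup_mul, ENNReal.mul_iSup]
  refine iSup_le fun m => iSup_le fun n => ?_
  refine prekopaLeindler_real_of_iSup_ne_top ha hb hab (hf.min measurable_const)
    (hg.min measurable_const) hh (hbdd f n) (hbdd g m) fun x y => ?_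
  exact (mul_le_mul' (ENNReal.rpow_le_rpow (min_le_left _ _) ha.le)
    (ENNReal.rpow_le_rpow (min_le_left _ _) hb.le)).trans (H x y)

/-- The Prékopa–Leindler inequality tensorizes: apply it to the sections, then to the
marginals. -/
theorem PrekopaLeindler.prod {E F : Type*} [AddCommGroup E] [Module ℝ E] [MeasurableSpace E]
    [AddCommGroup F] [Module ℝ F] [MeasurableSpace F] {μ : Measure E} {ν : Measure F} [SFinite ν]
    {a b : ℝ} (hμ : PrekopaLeindler μ a b) (hν : PrekopaLeindler ν a b) :
    PrekopaLeindler (μ.prod ν) a b := by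
  intro f g h hf hg hh H
  rw [lintegral_prod _ hf.aemeasurable, lintegral_prod _ hg.aemeasurable,
    lintegral_prod _ hh.aemeasurable]
  refine hμ _ _ _ hf.lintegral_prod_right' hg.lintegral_prod_right' hh.lintegral_prod_right' ?_
  intro x x'
  exact hν _ _ _ (hf.comp measurable_prodMk_left) (hg.comp measurable_prodMk_left)
    (hh.comp measurable_prodMk_left) fun y y' => H (x, y) (x', y')

theorem PrekopaLeindler.of_measurePreserving {E F : Type*} [AddCommGroup E] [Module ℝ E]
    [MeasurableSpace E] [AddCommGroup F] [Module ℝ F] [MeasurableSpace F] {μ : Measure E}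
    {ν : Measure F} {a b : ℝ} (hμ : PrekopaLeindler μ a b) (e : E →ₗ[ℝ] F)
    (he : MeasurePreserving e μ ν) : PrekopaLeindler ν a b := by
  intro f g h hf hg hh H
  rw [← he.lintegral_comp hf, ← he.lintegral_comp hg, ← he.lintegral_comp hh]
  refine hμ _ _ _ (hf.comp he.measurable) (hg.comp he.measurable) (hh.comp he.measurable) ?_
  intro x y
  simpa using H (e x) (e y)

theorem prekopaLeindler_pi {a b : ℝ} (ha : 0 < a) (hb : 0 < b) (hab : a + b = 1) (n : ℕ) :
    PrekopaLeindler (volume : Measure (Fin n → ℝ)) a b := by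
  induction n with
  | zero =>
    intro f g h hf hg hh H
    rw [Measure.volume_pi_eq_dirac 0, lintegral_dirac, lintegral_dirac, lintegral_dirac]
    simpa using H 0 0
  | succ n ih =>
    refine ((prekopaLeindler_real ha hb hab).prod ih).of_measurePreserving
      (Fin.consLinearEquiv ℝ (fun _ : Fin (n + 1) => ℝ)).toLinearMap ?_
    have hcons : ⇑(Fin.consLinearEquiv ℝ fun _ : Fin (n + 1) => ℝ).toLinearMap =
        ⇑(MeasurableEquiv.piFinSuccAbove (fun _ : Fin (n + 1) => ℝ) 0).symm := by
      funext x
      simp [MeasurableEquiv.piFinSuccAbove_symm_apply, Fin.consLinearEquiv, Fin.consEquiv,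
        Fin.insertNthEquiv]
    rw [hcons]
    exact (volume_preserving_piFinSuccAbove (fun _ : Fin (n + 1) => ℝ) 0).symm

theorem prekopaLeindler_euclideanSpace {a b : ℝ} (ha : 0 < a) (hb : 0 < b) (hab : a + b = 1)
    (d : ℕ) : PrekopaLeindler (volume : Measure (EuclideanSpace ℝ (Fin d))) a b :=
  (prekopaLeindler_pi ha hb hab d).of_measurePreserving
    (WithLp.linearEquiv 2 ℝ (Fin d → ℝ)).symm.toLinearMap (PiLp.volume_preserving_toLp (Fin d))

/-! ### The Laplace transform of the squared norm -/

/-- The Laplace transform `s ↦ ∫ exp (-s ‖x‖² / 2) dπ` of half the squared norm under `π`. -/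
def sqNormLaplace {d : ℕ} (π : Measure (EuclideanSpace ℝ (Fin d))) (s : ℝ) : ℝ :=
  ∫ x, Real.exp (-(s * ‖x‖ ^ 2 / 2)) ∂π

section

variable {d : ℕ} {π : Measure (EuclideanSpace ℝ (Fin d))}

theorem integrable_exp_neg_sqNorm [IsProbabilityMeasure π] {s : ℝ} (hs : 0 ≤ s) :
    Integrable (fun x => Real.exp (-(s * ‖x‖ ^ 2 / 2))) π := by
  refine Integrable.of_bound (by fun_prop) 1 (Filter.Eventually.of_forall fun x => ?_)
  rw [Real.norm_eq_abs, Real.abs_exp, Real.exp_le_one_iff, neg_nonpos]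
  positivity

theorem sqNormLaplace_pos [IsProbabilityMeasure π] {s : ℝ} (hs : 0 ≤ s) :
    0 < sqNormLaplace π s :=
  integral_exp_pos (integrable_exp_neg_sqNorm hs)

theorem exp_log_sqNormLaplace [IsProbabilityMeasure π] {s : ℝ} (hs : 0 ≤ s) :
    Real.exp (Real.log (sqNormLaplace π s)) = sqNormLaplace π s :=
  Real.exp_log (sqNormLaplace_pos hs)

theorem lintegral_exp_neg_sqNorm [IsProbabilityMeasure π] {s : ℝ} (hs : 0 ≤ s) :
    ∫⁻ x, ENNReal.ofReal (Real.exp (-(s * ‖x‖ ^ 2 / 2))) ∂π =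
      ENNReal.ofReal (sqNormLaplace π s) :=
  (ofReal_integral_eq_lintegral_ofReal (integrable_exp_neg_sqNorm hs)
    (Filter.Eventually.of_forall fun _ => (Real.exp_pos _).le)).symm

/-- Jensen's inequality for the exponential function bounds the Laplace transform below by the
second moment. -/
theorem neg_mul_le_log_sqNormLaplace [IsProbabilityMeasure π] {R : ℝ}
    (hmoment : ∫⁻ x, ENNReal.ofReal (‖x‖ ^ 2) ∂π = ENNReal.ofReal (R ^ 2)) {s : ℝ} (hs : 0 ≤ s) :
    -(s * R ^ 2 / 2) ≤ Real.log (sqNormLaplace π s) := by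
  have hnn : 0 ≤ᵐ[π] fun x => ‖x‖ ^ 2 := Filter.Eventually.of_forall fun x => sq_nonneg _
  have hint : Integrable (fun x => ‖x‖ ^ 2) π := by
    refine ⟨by fun_prop, ?_⟩
    rw [hasFiniteIntegral_iff_ofReal hnn, hmoment]
    exact ENNReal.ofReal_lt_top
  have hval : ∫ x, ‖x‖ ^ 2 ∂π = R ^ 2 := by
    rw [integral_eq_lintegral_of_nonneg_ae hnn (by fun_prop), hmoment,
      ENNReal.toReal_ofReal (sq_nonneg R)]
  have h := convexOn_exp.map_integral_le (μ := π) (f := fun x => -(s * ‖x‖ ^ 2 / 2))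
    Real.continuous_exp.continuousOn isClosed_univ (by simp)
    ((hint.const_mul s).div_const 2).neg (integrable_exp_neg_sqNorm hs)
  rw [integral_neg, integral_div, integral_const_mul, hval] at h
  exact (Real.le_log_iff_exp_le (sqNormLaplace_pos hs)).2 h

/-- Convexity of the log-Laplace transform, which vanishes at `0`: its slope from the origin is
nondecreasing. -/
theorem log_sqNormLaplace_le [IsProbabilityMeasure π] {s t : ℝ} (hs : 0 < s) (hst : s ≤ t) :
    Real.log (sqNormLaplace π s) ≤ s / t * Real.log (sqNormLaplace π t) := by
  have ht : 0 < t := hs.trans_le hst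
  have hp : 0 ≤ s / t := by positivity
  have hcomp : ∀ x : EuclideanSpace ℝ (Fin d), Real.exp (-(t * ‖x‖ ^ 2 / 2)) ^ (s / t) =
      Real.exp (-(s * ‖x‖ ^ 2 / 2)) := by
    intro x
    rw [← Real.exp_mul]
    congr 1
    field_simp
  have h := (Real.concaveOn_rpow hp ((div_le_one ht).2 hst)).le_map_integral (μ := π)
    (f := fun x => Real.exp (-(t * ‖x‖ ^ 2 / 2)))
    (Real.continuous_rpow_const hp).continuousOn isClosed_Ici
    (Filter.Eventually.of_forall fun x => (Real.exp_pos _).le)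
    (integrable_exp_neg_sqNorm ht.le)
    (by simpa only [Function.comp_def, hcomp] using integrable_exp_neg_sqNorm hs.le)
  simp only [hcomp] at h
  rw [← Real.log_rpow (sqNormLaplace_pos ht.le)]
  exact Real.log_le_log (sqNormLaplace_pos hs.le) h

theorem IsLogConcave.rpow_mul_rpow_le {f : EuclideanSpace ℝ (Fin d) → ℝ} (hf : IsLogConcave f)
    {a b : ℝ} (ha : 0 < a) (hb : 0 < b) (hab : a + b = 1) (x y : EuclideanSpace ℝ (Fin d)) :
    f x ^ a * f y ^ b ≤ f (a • x + b • y) := by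
  rcases (hf.1 x).eq_or_lt with hx | hx
  · simpa [← hx, ha.ne'] using hf.1 (a • x + b • y)
  rcases (hf.1 y).eq_or_lt with hy | hy
  · simpa [← hy, hb.ne'] using hf.1 (a • x + b • y)
  have hpos : 0 < f (a • x + b • y) := hf.2.1 hx hy ha.le hb.le hab
  have h := hf.2.2 hx hy ha.le hb.le hab
  simp only [smul_eq_mul] at h
  rw [← Real.log_le_log_iff (by positivity) hpos, Real.log_mul (by positivity) (by positivity),
    Real.log_rpow hx, Real.log_rpow hy]
  linarith

/-- Joint convexity of `(x, u) ↦ ‖x‖² / u`, with `u = 1 / s`. -/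
theorem mul_sqNorm_convexCombination_le {a b r s t : ℝ} (ha : 0 < a) (hb : 0 < b) (hr : 0 < r)
    (hs : 0 < s) (ht : 0 < t) (hrst : 1 / s = a / r + b / t) (x y : EuclideanSpace ℝ (Fin d)) :
    s * ‖a • x + b • y‖ ^ 2 ≤ a * (r * ‖x‖ ^ 2) + b * (t * ‖y‖ ^ 2) := by
  have hnorm : ‖a • x + b • y‖ ≤ a * ‖x‖ + b * ‖y‖ := by
    refine (norm_add_le _ _).trans_eq ?_
    rw [norm_smul, norm_smul, Real.norm_of_nonneg ha.le, Real.norm_of_nonneg hb.le]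
  have hsq : ‖a • x + b • y‖ ^ 2 ≤ (a * ‖x‖ + b * ‖y‖) ^ 2 :=
    pow_le_pow_left₀ (norm_nonneg _) hnorm 2
  have hCS : (a * ‖x‖ + b * ‖y‖) ^ 2 ≤
      (a / r + b / t) * (a * (r * ‖x‖ ^ 2) + b * (t * ‖y‖ ^ 2)) := by
    have : (a / r + b / t) * (a * (r * ‖x‖ ^ 2) + b * (t * ‖y‖ ^ 2)) -
        (a * ‖x‖ + b * ‖y‖) ^ 2 = a * b * (r * ‖x‖ - t * ‖y‖) ^ 2 / (r * t) := by
      field_simp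
      ring
    have : 0 ≤ a * b * (r * ‖x‖ - t * ‖y‖) ^ 2 / (r * t) := by positivity
    linarith
  calc s * ‖a • x + b • y‖ ^ 2
      ≤ s * (1 / s * (a * (r * ‖x‖ ^ 2) + b * (t * ‖y‖ ^ 2))) := by
        rw [hrst]
        exact mul_le_mul_of_nonneg_left (hsq.trans hCS) hs.le
    _ = a * (r * ‖x‖ ^ 2) + b * (t * ‖y‖ ^ 2) := by field_simp

/-- For log-concave `π`, the log-Laplace transform of the squared norm is concave as a function of
`1 / s`: it is the logarithm of a marginal of a function that is log-concave jointly in `x` and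
`1 / s`. -/
theorem IsLogConcaveMeasure.log_sqNormLaplace_concave [IsProbabilityMeasure π]
    (hπ : IsLogConcaveMeasure π) {a b r s t : ℝ} (ha : 0 < a) (hb : 0 < b) (hab : a + b = 1)
    (hr : 0 < r) (hs : 0 < s) (ht : 0 < t) (hrst : 1 / s = a / r + b / t) :
    a * Real.log (sqNormLaplace π r) + b * Real.log (sqNormLaplace π t) ≤
      Real.log (sqNormLaplace π s) := by
  have hrpos := sqNormLaplace_pos (π := π) hr.le
  have htpos := sqNormLaplace_pos (π := π) ht.le
  have hspos := sqNormLaplace_pos (π := π) hs.le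
  obtain ⟨f, hfm, hf, hfπ⟩ := hπ
  have hdens : ∀ u : ℝ, 0 < u → ENNReal.ofReal (sqNormLaplace π u) =
      ∫⁻ x, ENNReal.ofReal (f x * Real.exp (-(u * ‖x‖ ^ 2 / 2))) := by
    intro u hu
    rw [← lintegral_exp_neg_sqNorm hu.le]
    conv_lhs => rw [hfπ]
    rw [lintegral_withDensity_eq_lintegral_mul _ (by fun_prop) (by fun_prop)]
    simp only [Pi.mul_apply, ENNReal.ofReal_mul (hf.1 _)]
  have hpl := prekopaLeindler_euclideanSpace ha hb hab d
    (fun x => ENNReal.ofReal (f x * Real.exp (-(r * ‖x‖ ^ 2 / 2))))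
    (fun x => ENNReal.ofReal (f x * Real.exp (-(t * ‖x‖ ^ 2 / 2))))
    (fun x => ENNReal.ofReal (f x * Real.exp (-(s * ‖x‖ ^ 2 / 2))))
    (by fun_prop) (by fun_prop) (by fun_prop) (fun x y => by
      have hx := hf.1 x
      have hy := hf.1 y
      rw [ENNReal.ofReal_rpow_of_nonneg (by positivity) ha.le,
        ENNReal.ofReal_rpow_of_nonneg (by positivity) hb.le,
        ← ENNReal.ofReal_mul (by positivity)]
      apply ENNReal.ofReal_le_ofReal
      rw [Real.mul_rpow hx (Real.exp_pos _).le, Real.mul_rpow hy (Real.exp_pos _).le,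
        ← Real.exp_mul, ← Real.exp_mul, mul_mul_mul_comm, ← Real.exp_add]
      refine mul_le_mul (hf.rpow_mul_rpow_le ha hb hab x y) (Real.exp_le_exp.2 ?_)
        (Real.exp_pos _).le (hf.1 _)
      have := mul_sqNorm_convexCombination_le ha hb hr hs ht hrst x y
      linarith)
  rw [← hdens r hr, ← hdens t ht, ← hdens s hs, ENNReal.ofReal_rpow_of_pos hrpos,
    ENNReal.ofReal_rpow_of_pos htpos, ← ENNReal.ofReal_mul (by positivity),
    ENNReal.ofReal_le_ofReal_iff hspos.le] at hpl
  rw [← Real.log_rpow hrpos, ← Real.log_rpow htpos,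
    ← Real.log_mul (by positivity) (by positivity)]
  exact Real.log_le_log (by positivity) hpl

/-! ### Gaussian tilts and their Rényi divergence -/

/-- Gaussian tilting is exponential tilting by `-‖x‖² / (2 t)`: the Gaussian normalization
cancels. -/
theorem gaussianTilt_eq_withDensity [IsProbabilityMeasure π] {t : ℝ} (ht : 0 < t) :
    gaussianTilt π t = π.withDensity (fun x => ENNReal.ofReal
      (Real.exp (-(t⁻¹ * ‖x‖ ^ 2 / 2) - Real.log (sqNormLaplace π t⁻¹)))) := by
  have hs : 0 ≤ t⁻¹ := by positivity
  have hZ := sqNormLaplace_pos (π := π) hs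
  set C : ℝ := (2 * Real.pi * t) ^ (-(d : ℝ) / 2) with hC
  have hCpos : 0 < C := by positivity
  have hdens : ∀ x, ENNReal.ofReal (gaussianDensity d t x) =
      ENNReal.ofReal C * ENNReal.ofReal (Real.exp (-(t⁻¹ * ‖x‖ ^ 2 / 2))) := by
    intro x
    rw [← ENNReal.ofReal_mul hCpos.le, gaussianDensity]
    congr 3
    field_simp
  unfold gaussianTilt
  simp only [hdens]
  rw [lintegral_const_mul _ (by fun_prop), lintegral_exp_neg_sqNorm hs,
    ← ENNReal.ofReal_mul hCpos.le, ← ENNReal.ofReal_inv_of_pos (by positivity),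
    ← withDensity_smul _ (by fun_prop)]
  congr 1
  funext x
  rw [Pi.smul_apply, smul_eq_mul, ← ENNReal.ofReal_mul hCpos.le,
    ← ENNReal.ofReal_mul (by positivity), Real.exp_sub, exp_log_sqNormLaplace hs]
  congr 1
  field_simp

theorem renyiDiv_withDensity_exp {Ω : Type*} [MeasurableSpace Ω] {μ : Measure Ω} [SigmaFinite μ]
    {φ ψ : Ω → ℝ} (hφ : Measurable φ) (hψ : Measurable ψ) (q : ℝ) :
    renyiDiv q (μ.withDensity fun x => ENNReal.ofReal (Real.exp (φ x)))
        (μ.withDensity fun x => ENNReal.ofReal (Real.exp (ψ x))) =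
      ((1 / (q - 1) : ℝ) : EReal) *
        ENNReal.log (∫⁻ x, ENNReal.ofReal (Real.exp (q * φ x - (q - 1) * ψ x)) ∂μ) := by
  have hρm : Measurable fun x => ENNReal.ofReal (Real.exp (φ x - ψ x)) := by fun_prop
  have hψm : Measurable fun x => ENNReal.ofReal (Real.exp (ψ x)) := by fun_prop
  have hμ : (μ.withDensity fun x => ENNReal.ofReal (Real.exp (φ x))) =
      (μ.withDensity fun x => ENNReal.ofReal (Real.exp (ψ x))).withDensity
        fun x => ENNReal.ofReal (Real.exp (φ x - ψ x)) := by
    rw [← withDensity_mul _ hψm hρm]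
    congr 1
    funext x
    rw [Pi.mul_apply, ← ENNReal.ofReal_mul (Real.exp_pos _).le, ← Real.exp_add,
      add_sub_cancel]
  rw [renyiDiv, hμ, if_pos (withDensity_absolutelyContinuous _ _)]
  congr 2
  refine (lintegral_congr_ae ((Measure.rnDeriv_withDensity _ hρm).fun_comp (· ^ q))).trans ?_
  refine (lintegral_withDensity_eq_lintegral_mul _ hψm (hρm.pow_const q)).trans ?_
  refine lintegral_congr fun x => ?_
  rw [Pi.mul_apply, ENNReal.ofReal_rpow_of_pos (Real.exp_pos _), ← Real.exp_mul,
    ← ENNReal.ofReal_mul (Real.exp_pos _).le, ← Real.exp_add]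
  congr 2
  ring

/-- The Rényi divergence within the exponential family generated by `-‖x‖² / 2`, in terms of the
log-Laplace transform at an extrapolated parameter. -/
theorem renyiDiv_gaussianTilt [IsProbabilityMeasure π] {q t u : ℝ} (ht : 0 < t) (hu : 0 < u)
    (hr : 0 ≤ q * t⁻¹ - (q - 1) * u⁻¹) :
    renyiDiv q (gaussianTilt π t) (gaussianTilt π u) =
      ((1 / (q - 1) * (Real.log (sqNormLaplace π (q * t⁻¹ - (q - 1) * u⁻¹)) -
        q * Real.log (sqNormLaplace π t⁻¹) + (q - 1) * Real.log (sqNormLaplace π u⁻¹)) : ℝ) :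
        EReal) := by
  rw [gaussianTilt_eq_withDensity ht, gaussianTilt_eq_withDensity hu,
    renyiDiv_withDensity_exp (by fun_prop) (by fun_prop), EReal.coe_mul]
  congr 1
  generalize Real.log (sqNormLaplace π t⁻¹) = L
  generalize Real.log (sqNormLaplace π u⁻¹) = L'
  have hpt : ∀ x : EuclideanSpace ℝ (Fin d), ENNReal.ofReal (Real.exp
      (q * (-(t⁻¹ * ‖x‖ ^ 2 / 2) - L) - (q - 1) * (-(u⁻¹ * ‖x‖ ^ 2 / 2) - L'))) =
      ENNReal.ofReal (Real.exp (-q * L + (q - 1) * L')) *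
        ENNReal.ofReal (Real.exp (-((q * t⁻¹ - (q - 1) * u⁻¹) * ‖x‖ ^ 2 / 2))) := by
    intro x
    rw [← ENNReal.ofReal_mul (Real.exp_pos _).le, ← Real.exp_add]
    congr 2
    ring
  have hZ := sqNormLaplace_pos (π := π) hr
  simp only [hpt]
  rw [lintegral_const_mul _ (by fun_prop), lintegral_exp_neg_sqNorm hr,
    ← ENNReal.ofReal_mul (Real.exp_pos _).le, ENNReal.log_ofReal_of_pos (by positivity),
    Real.log_mul (Real.exp_pos _).ne' hZ.ne', Real.log_exp]
  congr 1
  ring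

/-- With `r = q / v - (q - 1) / (v (1 + α)) = (1 + q α) / (v (1 + α))`, the variance `v` is a convex
combination of `1 / r` and `v (1 + α)`. Concavity in the variance removes the log-Laplace transform
at `1 / v` from the Rényi divergence; the remaining increment between `1 / (v (1 + α))` and `r` is
bounded by convexity in the precision. -/
theorem IsLogConcaveMeasure.renyiDiv_gaussianTilt_le [IsProbabilityMeasure π]
    (hπ : IsLogConcaveMeasure π) {R : ℝ}
    (hmoment : ∫⁻ x, ENNReal.ofReal (‖x‖ ^ 2) ∂π = ENNReal.ofReal (R ^ 2))
    {α v q : ℝ} (hα : 0 < α) (hv : 0 < v) (hq : 1 < q) :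
    renyiDiv q (gaussianTilt π v) (gaussianTilt π (v * (1 + α))) ≤
      ((q * α ^ 2 * R ^ 2 / (2 * v * (1 + α) ^ 2) : ℝ) : EReal) := by
  have hq0 : 0 < q := by linarith
  have hq1 : 0 < q - 1 := by linarith
  have hr : q * v⁻¹ - (q - 1) * (v * (1 + α))⁻¹ = (1 + q * α) / (v * (1 + α)) := by
    field_simp
    ring
  have hrpos : 0 < (1 + q * α) / (v * (1 + α)) := by positivity
  rw [renyiDiv_gaussianTilt hv (by positivity) (hr ▸ hrpos.le), hr, EReal.coe_le_coe_iff]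
  set s' := (v * (1 + α))⁻¹ with hs'
  have hs'pos : 0 < s' := by positivity
  have hconc := hπ.log_sqNormLaplace_concave (a := (1 + q * α) / (q * (1 + α)))
    (b := (q - 1) / (q * (1 + α))) (by positivity) (by positivity) (by field_simp; ring)
    hrpos (inv_pos.2 hv) hs'pos (by rw [hs']; field_simp; ring)
  have hconv := log_sqNormLaplace_le (π := π) hs'pos
    (t := (1 + q * α) / (v * (1 + α))) (by
      rw [hs', div_eq_mul_inv]
      exact le_mul_of_one_le_left (by positivity) (by nlinarith))
  have hmom := neg_mul_le_log_sqNormLaplace hmoment hs'pos.le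
  set L := Real.log (sqNormLaplace π v⁻¹)
  set L' := Real.log (sqNormLaplace π s')
  set L₁ := Real.log (sqNormLaplace π ((1 + q * α) / (v * (1 + α))))
  have hslope : s' / ((1 + q * α) / (v * (1 + α))) = 1 / (1 + q * α) := by
    rw [hs']
    field_simp
  rw [hslope, one_div_mul_eq_div, le_div_iff₀ (by positivity)] at hconv
  have hdiff : L' - L₁ ≤ q * α * (s' * R ^ 2 / 2) := by
    have := mul_le_mul_of_nonneg_left hmom (by positivity : 0 ≤ q * α)
    linarith
  have hnum : L₁ - q * L + (q - 1) * L' ≤ (q - 1) * (α / (1 + α) * (L' - L₁)) := by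
    have h := mul_le_mul_of_nonneg_left hconc hq0.le
    have e : q * ((1 + q * α) / (q * (1 + α)) * L₁ + (q - 1) / (q * (1 + α)) * L') =
        L₁ + (q - 1) * L' - (q - 1) * (α / (1 + α) * (L' - L₁)) := by
      field_simp
      ring
    linarith
  calc 1 / (q - 1) * (L₁ - q * L + (q - 1) * L')
      ≤ 1 / (q - 1) * ((q - 1) * (α / (1 + α) * (L' - L₁))) := by gcongr
    _ = α / (1 + α) * (L' - L₁) := by field_simp
    _ ≤ α / (1 + α) * (q * α * (s' * R ^ 2 / 2)) := by gcongr
    _ = q * α ^ 2 * R ^ 2 / (2 * v * (1 + α) ^ 2) := by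
        rw [hs']
        field_simp

end

end
theorem mainTheorem8 {d : ℕ} (π : Measure (EuclideanSpace ℝ (Fin d))) [IsProbabilityMeasure π]
    (hπ : IsLogConcaveMeasure π) (R : ℝ) (hR : 0 ≤ R)
    (hmoment : ∫⁻ x, ENNReal.ofReal (‖x‖ ^ 2) ∂π = ENNReal.ofReal (R ^ 2))
    (α σ q : ℝ) (hα : 0 < α) (hσ : 0 < σ) (hq : 1 < q) :
    renyiDiv q (gaussianTilt π (σ ^ 2)) (gaussianTilt π (σ ^ 2 * (1 + α))) ≤
        ((q ^ 2 * α ^ 2 * R ^ 2 / (2 * σ ^ 2) : ℝ) : EReal) ∧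
      (α * (q * R) ≤ σ →
        renyiDiv q (gaussianTilt π (σ ^ 2)) (gaussianTilt π (σ ^ 2 * (1 + α))) ≤
          ((1 / 2 : ℝ) : EReal)) := by
  have hmain : renyiDiv q (gaussianTilt π (σ ^ 2)) (gaussianTilt π (σ ^ 2 * (1 + α))) ≤
      ((q ^ 2 * α ^ 2 * R ^ 2 / (2 * σ ^ 2) : ℝ) : EReal) := by
    refine (hπ.renyiDiv_gaussianTilt_le hmoment hα (by positivity) hq).trans ?_
    rw [EReal.coe_le_coe_iff]
    have h1 : q ≤ q ^ 2 := by nlinarith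
    have h2 : 1 ≤ (1 + α) ^ 2 := by nlinarith
    apply div_le_div₀ (by positivity) (by gcongr) (by positivity)
    exact le_mul_of_one_le_right (by positivity) h2
  refine ⟨hmain, fun h => hmain.trans ?_⟩
  rw [EReal.coe_le_coe_iff, div_le_div_iff₀ (by positivity) two_pos]
  have h0 : 0 ≤ α * (q * R) := by positivity
  have := pow_le_pow_left₀ h0 h 2
  nlinarith
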